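/- Let $\mathcal M=(S,A,R,P,\rho_0)$ be a Markov decision process with countable state space $S$, countable action space $A$, bounded reward $R:S\to\mathbb R$, transition probabilities $P(s'\mid s,a)$ and initial distribution $\rho_0$. A policy $\pi$ assigns to every state $s$ a probability distribution $\pi(s,\cdot)$ on $A$; it induces the Markov chain with transition matrix $M_\pi(s,s')=\sum_a\pi(s,a)P(s'\mid s,a)$ and the marginal distributions $\rho_\pi^{(0)}=\rho_0$, $\rho_\pi^{(t+1)}=\rho_\pi^{(t)}M_\pi$. Let $S_\pi=\{s:\rho_\pi^{(t)}(s)>0\text{ for some }t\ge 1\}$ be the set of states reachable under $\pi$. Suppose that $\mathcal M$ is an *episodic learning process*, that is: 1. (Homogeneity) $P(\cdot\mid s,a)=P(\cdot\mid s',a')$ for all $a,a'\in A$ and all $s,s'$ with $\rho_0(s)\rho_0(s')>0$. Let $S_\perp$ be the largest subset of $S$ that contains $\{s:\rho_0(s)>0\}$ and satisfies $P(\cdot\mid s,a)=P(\cdot\mid s',a')$ for all $s,s'\in S_\perp$, $a,a'\in A$; its elements are the terminal states. An episode is a finite sequence $\xi=(s_0,\dots,s_T)$ with $T\ge 1$,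 $s_0,s_T\in S_\perp$ and $s_\tau\notin S_\perp$ for $0<\tau<T$; its length is $|\xi|=T$. 2. (Finiteness) For every policy $\pi$, with $\mathbb P_\pi(\xi)=\rho_0(s_0)\prod_{t=1}^{T}M_\pi(s_{t-1},s_t)$ and $\Xi_\pi=\{\xi:\ \xi\text{ is an episode and }\mathbb P_\pi(\xi)>0\}$ (the admissible episodes), one has $\sum_{\xi\in\Xi_\pi}\mathbb P_\pi(\xi)=1$ and $\sum_{\xi\in\Xi_\pi}\mathbb P_\pi(\xi)\,|\xi|<\infty$. Let $\pi$ be a policy for which there are different $\xi,\xi'\in\Xi_\pi$ with $\gcd(|\xi|,|\xi'|)=1$. Then there is exactly one probability distribution $\rho_\pi$ on $S$ that vanishes outside $S_\pi$ and satisfies $\rho_\pi=\rho_\pi M_\pi$, and the marginal distributions converge to it: $\lim_{t\to\infty}\rho_\pi^{(t)}(s)=\rho_\pi(s)$ for every $s\in S$. -/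

import Mathlib

open Filter Topology
open scoped ENNReal

/-- A Markov decision process with state space `S` and action space `A` (both taken countable in
the theorem): a bounded reward, action-conditioned transition probabilities
`transition s a s' = P(s' | s, a)`, and an initial state distribution. -/
structure MDP (S A : Type*) where
  reward : S → ℝ
  reward_bounded : ∃ rMin rMax : ℝ, ∀ s, reward s ∈ Set.Icc rMin rMax
  transition : S → A → PMF S
  init : PMF S

/-- A finite trajectory segment `(s_0, s_1, …, s_len)`; `len` is the number of transitions. -/
structure Segment (S : Type*) where
  len : ℕ
  state : Fin (len + 1) → S

namespace MDP

variable {S A : Type*}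

/-- A (stationary, randomized) policy: `π s a` is the probability to take action `a` in `s`. -/
abbrev Policy (S A : Type*) := S → PMF A

/-- The transition matrix `M_π` of the Markov chain induced by `π`; row `s` is a distribution. -/
noncomputable def chain (M : MDP S A) (π : Policy S A) (s : S) : PMF S :=
  (π s).bind (M.transition s)

theorem chain_apply (M : MDP S A) (π : Policy S A) (s s' : S) :
    M.chain π s s' = ∑' a, π s a * M.transition s a s' :=
  PMF.bind_apply _ _ _

/-- The marginal distribution `ρ_π^(t)` of the state at time `t`: `ρ^(0)` is the initial
distribution and `ρ^(t+1) = ρ^(t) M_π`. -/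
noncomputable def marginal (M : MDP S A) (π : Policy S A) : ℕ → PMF S
  | 0 => M.init
  | t + 1 => (M.marginal π t).bind (M.chain π)

/-- The set `S_π` of states reachable under `π` (in at least one step). -/
def reachable (M : MDP S A) (π : Policy S A) : Set S :=
  {s | ∃ t, 1 ≤ t ∧ 0 < M.marginal π t s}

/-- Homogeneity: all initial states have identical, action-agnostic transition probabilities. -/
def Homogeneous (M : MDP S A) : Prop :=
  ∀ s s' : S, ∀ a a' : A, 0 < M.init s * M.init s' → M.transition s a = M.transition s' a'

/-- The set of terminal states: all states sharing the (action-agnostic) transition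
probabilities of the initial states. See `isGreatest_terminal`. -/
def terminal (M : MDP S A) : Set S :=
  {s | ∀ s₀, 0 < M.init s₀ → ∀ a a', M.transition s a = M.transition s₀ a'}

/-- Under homogeneity, `M.terminal` is the largest set of states that contains the initial states
and all of whose members have identical, action-agnostic transition probabilities. -/
theorem isGreatest_terminal [Nonempty A] (M : MDP S A) (h : M.Homogeneous) :
    IsGreatest {U : Set S | {s | 0 < M.init s} ⊆ U ∧
      ∀ s ∈ U, ∀ s' ∈ U, ∀ a a' : A, M.transition s a = M.transition s' a'} M.terminal := by
  refine ⟨⟨fun s hs s₀ h₀ a a' => h s s₀ a a' (ENNReal.mul_pos hs.ne' h₀.ne'), ?_⟩, ?_⟩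
  · intro s hs s' hs' a a'
    obtain ⟨s₀, h₀⟩ := M.init.support_nonempty
    have h₀' : 0 < M.init s₀ := pos_iff_ne_zero.mpr h₀
    exact (hs s₀ h₀' a a').trans (hs' s₀ h₀' a' a').symm
  · rintro U ⟨hU, hU'⟩ s hs s₀ h₀ a a'
    exact hU' s hs s₀ (hU h₀) a a'

/-- An episode: a segment with at least one transition that starts and ends in a terminal state
and visits no terminal state in between. Its length is `ξ.len`. -/
def IsEpisode (M : MDP S A) (ξ : Segment S) : Prop :=
  1 ≤ ξ.len ∧ ξ.state 0 ∈ M.terminal ∧ ξ.state (Fin.last ξ.len) ∈ M.terminal ∧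
    ∀ i, i ≠ 0 → i ≠ Fin.last ξ.len → ξ.state i ∉ M.terminal

/-- The probability `P_π(ξ)` that the rollout of `π` from the initial distribution begins with
`ξ`. -/
noncomputable def segProb (M : MDP S A) (π : Policy S A) (ξ : Segment S) : ℝ≥0∞ :=
  M.init (ξ.state 0) * ∏ i : Fin ξ.len, M.chain π (ξ.state i.castSucc) (ξ.state i.succ)

/-- The set `Ξ_π` of admissible episodes under `π`. -/
def admissible (M : MDP S A) (π : Policy S A) : Set (Segment S) :=
  {ξ | M.IsEpisode ξ ∧ 0 < M.segProb π ξ}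

/-- An episodic learning process: homogeneity, and, for every policy, almost surely finite
episodes with finite average length. -/
structure IsEpisodic (M : MDP S A) : Prop where
  homogeneous : M.Homogeneous
  sum_prob : ∀ π : Policy S A, ∑' ξ : M.admissible π, M.segProb π ξ = 1
  sum_length : ∀ π : Policy S A,
    ∑' ξ : M.admissible π, M.segProb π ξ * ((ξ : Segment S).len : ℝ≥0∞) < ⊤

/-- `ρ` is a stationary distribution of `M_π` on the reachable states (padded by zero on the
unreachable ones): `ρ = ρ M_π` and `ρ` vanishes outside `S_π`. -/
def IsStationary (M : MDP S A) (π : Policy S A) (ρ : PMF S) : Prop :=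
  ρ.bind (M.chain π) = ρ ∧ ∀ s, s ∉ M.reachable π → ρ s = 0

end MDP

/-!
Whatever the policy, the chain moves from every terminal state according to one and the same
distribution, namely the marginal distribution at time one. The visits to the terminal states
therefore form a renewal process. Let `g k` (`excursion`) be the law of the state at time `k + 1`
on the event that no terminal state was visited at the times `1, …, k`, let `f k` be the mass that
`g k` gives to the terminal states (the probability that an episode has length `k + 1`), and let
`u t` be the probability of being in a terminal state at time `t`. Decomposing at the last visit
to a terminal state before time `t + 1` gives
`ρ^(t+1) = ∑ k ≤ t, u (t - k) • g k` (`MDP.Homogeneous.marginal_succ_eq_sum`).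

Summing this identity over the terminal states gives the renewal equation, and summing it over all
states gives `∑ k ≤ t, u (t - k) * G k = 1`, where `G k` is the total mass of `g k`. Since the
episodes are almost surely finite, `G k` is the probability that an episode is longer than `k`, so
`m = ∑ k, G k` is the mean episode length, which is finite. The renewal theorem
(`tendsto_inv_tsum_of_renewal`) gives `u t → 1 / m`, whence by dominated convergence
`ρ^(t) → (1 / m) ∑ k, g k`; the limit is invariant by a direct computation.

The renewal theorem is proved by the argument of Erdős, Feller and Pollard: along an ultrafilter
on which `u n` tends to its greatest cluster point `x`, all shifted sequences `u (n - i)` converge,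
and their limits form a harmonic sequence bounded by `x` and equal to `x` at `0`. By the maximum
principle this sequence equals `x` on the additive monoid generated by two coprime episode lengths,
hence eventually, and the identity for `G` gives `x * m = 1`. The same applied to `-u` identifies
the least cluster point.

For uniqueness, an invariant `ρ` equals `c ∑ k < n, g k` plus the part of `ρ` that has not visited a
terminal state within `n` steps, where `c` is the mass of the terminal states under `ρ`. A state is
reachable only if it carries mass of some `g k`, and since `G n → 0` the probability to survive `n`
steps from it tends to zero; so the remainder vanishes in the limit.
-/

/-! ### The renewal theorem -/

/-- Tannery's theorem for convolutions. Only the values of `u (n - k)` with `k ≤ n` enter, so the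
truncation of the subtraction is harmless. -/
theorem tendsto_convolution {u w v : ℕ → ℝ} {l : Filter ℕ} (hl : l ≤ atTop)
    (hu : ∀ n, |u n| ≤ 1) (hw : Summable fun k => |w k|)
    (hv : ∀ k, Tendsto (fun n => u (n - k)) l (𝓝 (v k))) :
    Tendsto (fun n => ∑ k ∈ Finset.range (n + 1), u (n - k) * w k) l (𝓝 (∑' k, v k * w k)) := by
  have key : Tendsto (fun n => ∑' k, if k ∈ Finset.range (n + 1) then u (n - k) * w k else 0) l
      (𝓝 (∑' k, v k * w k)) := by
    refine tendsto_tsum_of_dominated_convergence hw (fun k => ?_) (.of_forall fun n k => ?_)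
    · refine ((hv k).mul_const (w k)).congr' ?_
      filter_upwards [hl (eventually_ge_atTop k)] with n hn
      rw [if_pos (Finset.mem_range.2 (by omega))]
    · split_ifs
      · rw [Real.norm_eq_abs, abs_mul]
        exact mul_le_of_le_one_left (abs_nonneg _) (hu _)
      · simp
  refine key.congr fun n => ?_
  rw [tsum_eq_sum (s := Finset.range (n + 1)) (fun k hk => if_neg hk)]
  exact Finset.sum_congr rfl fun k hk => if_pos hk

/-- The greatest cluster point of a solution of the renewal equation is determined by the
conserved quantity `∑ k ≤ n, u (n - k) * G k = c`. The value of `c` is kept free so that the lemma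
applies to `-u` as well. The index `k` of `f` stands for the waiting time `k + 1`. -/
theorem mul_tsum_eq_of_greatest_clusterPt {f G u : ℕ → ℝ} {c x : ℝ} (hu : ∀ n, |u n| ≤ 1)
    (hf0 : ∀ k, 0 ≤ f k) (hf : HasSum f 1) (hG : Summable fun k => |G k|)
    (hren : ∀ n, u (n + 1) = ∑ k ∈ Finset.range (n + 1), u (n - k) * f k)
    (hmass : ∀ n, ∑ k ∈ Finset.range (n + 1), u (n - k) * G k = c)
    {a b : ℕ} (ha : 0 < f a) (hb : 0 < f b) (hab : (a + 1).Coprime (b + 1))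
    (hx : MapClusterPt x atTop u) (hmax : ∀ y, MapClusterPt y atTop u → y ≤ x) :
    x * ∑' k, G k = c := by
  obtain ⟨U, hU, hUx⟩ := mapClusterPt_iff_ultrafilter.1 hx
  have hshift : ∀ k, Tendsto (fun n : ℕ => n - k) U atTop := fun k =>
    (tendsto_sub_atTop_nat k).mono_left hU
  have hlim : ∀ k, ∃ y ∈ Set.Icc (-1 : ℝ) 1, Tendsto (fun n => u (n - k)) U (𝓝 y) := fun k =>
    isCompact_Icc.ultrafilter_le_nhds (U.map fun n => u (n - k))
      (le_principal_iff.2 (mem_map.2 (univ_mem' fun n => abs_le.1 (hu (n - k)))))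
  choose v hv1 hv using hlim
  have hvle : ∀ k, v k ≤ x := fun k => hmax _ <| mapClusterPt_iff_ultrafilter.2
    ⟨U.map fun n => n - k, hshift k, hv k⟩
  have hv0 : v 0 = x := tendsto_nhds_unique (hv 0) hUx
  -- the sequence `v` of limits is harmonic, by the renewal equation at time `n - i`
  have hharm : ∀ i, v i = ∑' k, v (i + (k + 1)) * f k := by
    intro i
    have h1 := tendsto_convolution (u := u) (w := f) (v := fun k => v (i + (k + 1)))
      (l := (U : Filter ℕ).map fun n => n - (i + 1)) (hshift _) hu
      (by simpa only [abs_of_nonneg (hf0 _)] using hf.summable)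
      (fun k => by
        rw [tendsto_map'_iff]
        refine (hv (i + (k + 1))).congr fun n => ?_
        simp only [Function.comp]; congr 1; omega)
    refine tendsto_nhds_unique (hv i) ((tendsto_map'_iff.1 h1).congr' ?_)
    filter_upwards [hU (eventually_ge_atTop (i + 1))] with n hn
    simp only [Function.comp]
    rw [← hren]; congr 1; omega
  -- maximum principle: an average equal to the maximum forces equality on the support of `f`
  have hstep : ∀ i j, 0 < f j → v i = x → v (i + (j + 1)) = x := by
    intro i j hj hi
    have hs : Summable fun k => v (i + (k + 1)) * f k := by
      refine Summable.of_norm_bounded hf.summable fun k => ?_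
      rw [Real.norm_eq_abs, abs_mul, abs_of_nonneg (hf0 k)]
      exact mul_le_of_le_one_left (hf0 k) (abs_le.2 (hv1 _))
    have hz : HasSum (fun k => (x - v (i + (k + 1))) * f k) 0 := by
      have := (hf.mul_left x).sub hs.hasSum
      rw [← hharm, hi] at this
      simpa [sub_mul] using this
    have := (hasSum_zero_iff_of_nonneg fun k =>
      mul_nonneg (sub_nonneg.2 (hvle _)) (hf0 k)).1 hz
    have := congrFun this j
    simp only [Pi.zero_apply, mul_eq_zero, hj.ne', or_false] at this
    linarith
  have hmul : ∀ i j, v (i * (a + 1) + j * (b + 1)) = x := by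
    intro i j
    induction j with
    | zero =>
      induction i with
      | zero => simpa using hv0
      | succ i ih => convert hstep _ a ha ih using 2; ring
    | succ j ih => convert hstep _ b hb ih using 2; ring
  obtain ⟨K, hK⟩ : ∃ K, ∀ n, K ≤ n → v n = x := by
    refine ⟨(a + 1) * (b + 1), fun n hn => ?_⟩
    obtain ⟨i, j, h⟩ := Nat.exists_add_mul_eq_of_gcd_dvd_of_mul_pred_le (a + 1) (b + 1) n
      (by rw [hab.gcd_eq_one]; exact one_dvd _) (le_trans (by gcongr <;> simp) hn)
    rw [← h]
    exact hmul i j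
  have h1 := tendsto_convolution (u := u) (w := G) (v := fun k => v (K + k))
      (l := (U : Filter ℕ).map fun n => n - K) (hshift _) hu hG
      (fun k => by
        rw [tendsto_map'_iff]
        refine (hv (K + k)).congr fun n => ?_
        simp only [Function.comp]; congr 1; omega)
  simp only [hmass, hK _ (Nat.le_add_right _ _), tsum_mul_left] at h1
  have : ((U : Filter ℕ).map fun n => n - K).NeBot := inferInstance
  exact tendsto_nhds_unique h1 tendsto_const_nhds

/-- The renewal theorem, for waiting times `k + 1` of probability `f k` whose support contains two
coprime numbers. In the application `G k` is the probability of waiting longer than `k`. -/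
theorem tendsto_inv_tsum_of_renewal {f G u : ℕ → ℝ} (hu : ∀ n, |u n| ≤ 1)
    (hf0 : ∀ k, 0 ≤ f k) (hf : HasSum f 1) (hG : Summable fun k => |G k|)
    (hren : ∀ n, u (n + 1) = ∑ k ∈ Finset.range (n + 1), u (n - k) * f k)
    (hmass : ∀ n, ∑ k ∈ Finset.range (n + 1), u (n - k) * G k = 1)
    {a b : ℕ} (ha : 0 < f a) (hb : 0 < f b) (hab : (a + 1).Coprime (b + 1)) :
    Tendsto u atTop (𝓝 (∑' k, G k)⁻¹) := by
  have hcpt : ∀ w : ℕ → ℝ, (∀ n, |w n| ≤ 1) → ∀ U : Ultrafilter ℕ,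
      ∃ y ∈ Set.Icc (-1 : ℝ) 1, Tendsto w U (𝓝 y) := fun w hw U =>
    isCompact_Icc.ultrafilter_le_nhds (U.map w)
      (le_principal_iff.2 (mem_map.2 (univ_mem' fun n => abs_le.1 (hw n))))
  -- bounded sequences have a greatest cluster point
  have hgreatest : ∀ w : ℕ → ℝ, (∀ n, |w n| ≤ 1) →
      ∃ x, MapClusterPt x atTop w ∧ ∀ y, MapClusterPt y atTop w → y ≤ x := by
    intro w hw
    have hsub : {y | MapClusterPt y atTop w} ⊆ Set.Icc (-1 : ℝ) 1 := by
      intro y hy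
      obtain ⟨U, hU, hUy⟩ := mapClusterPt_iff_ultrafilter.1 hy
      obtain ⟨z, hz, hUz⟩ := hcpt w hw U
      exact tendsto_nhds_unique hUy hUz ▸ hz
    have hclosed : IsClosed {y | MapClusterPt y atTop w} := isClosed_setOfPred_clusterPt
    have hne : {y | MapClusterPt y atTop w}.Nonempty := by
      obtain ⟨y, -, hy⟩ := hcpt w hw (Ultrafilter.of atTop)
      exact ⟨y, mapClusterPt_iff_ultrafilter.2 ⟨_, Ultrafilter.of_le _, hy⟩⟩
    obtain ⟨x, hx, hx'⟩ := (isCompact_Icc.of_isClosed_subset hclosed hsub).exists_isGreatest hne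
    exact ⟨x, hx, fun y hy => hx' hy⟩
  obtain ⟨x, hx, hxmax⟩ := hgreatest u hu
  have hu' : ∀ n, |(-u) n| ≤ 1 := fun n => by simpa using hu n
  obtain ⟨z, hz, hzmax⟩ := hgreatest (-u) hu'
  have e1 := mul_tsum_eq_of_greatest_clusterPt hu hf0 hf hG hren hmass ha hb hab hx hxmax
  have e2 := mul_tsum_eq_of_greatest_clusterPt (c := -1) hu' hf0 hf hG
    (fun n => by simp [hren n]) (fun n => by simp [← hmass n]) ha hb hab hz hzmax
  have hm : ∑' k, G k ≠ 0 := fun h => by simp [h] at e1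
  have hx1 : x = (∑' k, G k)⁻¹ := eq_inv_of_mul_eq_one_left e1
  have hz1 : z = -(∑' k, G k)⁻¹ := by
    rw [← neg_eq_iff_eq_neg]; exact eq_inv_of_mul_eq_one_left (by linarith)
  rw [tendsto_iff_ultrafilter]
  intro U hU
  obtain ⟨y, -, hy⟩ := hcpt u hu U
  have h1 := hxmax y (mapClusterPt_iff_ultrafilter.2 ⟨U, hU, hy⟩)
  have h2 := hzmax (-y) (mapClusterPt_iff_ultrafilter.2 ⟨U, hU, hy.neg⟩)
  have : y = (∑' k, G k)⁻¹ := by linarith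
  exact this ▸ hy

/-! ### Transport of mass and the decomposition into episodes -/

namespace MDP

variable {S A : Type*}

/-- The image `a M_π` of a mass function `a` on the states under one step of the chain. Mass
functions are arbitrary functions to `ℝ≥0∞`, so that sub-probabilities are included. -/
noncomputable def push (M : MDP S A) (π : Policy S A) (a : S → ℝ≥0∞) (s' : S) : ℝ≥0∞ :=
  ∑' s, a s * M.chain π s s'

/-- One step of the chain after all mass on the terminal states has been removed. -/
noncomputable def killedPush (M : MDP S A) (π : Policy S A) (a : S → ℝ≥0∞) : S → ℝ≥0∞ :=
  M.push π (M.terminalᶜ.indicator a)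

/-- The law of the state at time `k + 1` on the event that no terminal state is visited at the
times `1, …, k`. -/
noncomputable def excursion (M : MDP S A) (π : Policy S A) (k : ℕ) : S → ℝ≥0∞ :=
  (M.killedPush π)^[k] (M.marginal π 1)

/-- The mass that `a` gives to the terminal states. -/
noncomputable def terminalMass (M : MDP S A) (a : S → ℝ≥0∞) : ℝ≥0∞ :=
  ∑' s, M.terminal.indicator a s

variable (M : MDP S A) (π : Policy S A)

theorem excursion_zero : M.excursion π 0 = M.marginal π 1 := rfl

theorem excursion_succ (k : ℕ) :
    M.excursion π (k + 1) = M.killedPush π (M.excursion π k) :=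
  Function.iterate_succ_apply' _ _ _

theorem push_marginal (t : ℕ) : M.push π (M.marginal π t) = M.marginal π (t + 1) :=
  funext fun _ => (PMF.bind_apply _ _ _).symm

theorem push_add (a b : S → ℝ≥0∞) : M.push π (a + b) = M.push π a + M.push π b := by
  funext s
  simp [push, add_mul, ENNReal.tsum_add]

theorem push_const_mul (c : ℝ≥0∞) (a : S → ℝ≥0∞) :
    M.push π (fun s => c * a s) = fun s => c * M.push π a s := by
  funext s
  simp [push, mul_assoc, ENNReal.tsum_mul_left]

theorem push_tsum {ι : Type*} (a : ι → S → ℝ≥0∞) :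
    M.push π (fun s => ∑' i, a i s) = fun s => ∑' i, M.push π (a i) s := by
  funext s
  simp only [push, ← ENNReal.tsum_mul_right]
  exact ENNReal.tsum_comm

theorem tsum_push (a : S → ℝ≥0∞) : ∑' s, M.push π a s = ∑' s, a s := by
  simp only [push]
  rw [ENNReal.tsum_comm]
  simp [ENNReal.tsum_mul_left, PMF.tsum_coe]

theorem indicator_terminal_add_compl (a : S → ℝ≥0∞) :
    M.terminal.indicator a + M.terminalᶜ.indicator a = a :=
  Set.indicator_self_add_compl _ _

theorem terminalMass_add_tsum_killedPush (a : S → ℝ≥0∞) :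
    M.terminalMass a + ∑' s, M.killedPush π a s = ∑' s, a s := by
  rw [killedPush, tsum_push, terminalMass, ← ENNReal.tsum_add]
  exact tsum_congr fun s => congrFun (M.indicator_terminal_add_compl a) s

variable {M}

theorem Homogeneous.mem_terminal (h : M.Homogeneous) {s : S} (hs : M.init s ≠ 0) :
    s ∈ M.terminal := fun s₀ h₀ a a' =>
  h s s₀ a a' (ENNReal.mul_pos hs h₀.ne')

/-- The chain regenerates at terminal states: the next state has the same law from each of them. -/
theorem Homogeneous.chain_eq_marginal_one (h : M.Homogeneous) {s : S} (hs : s ∈ M.terminal) :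
    M.chain π s = M.marginal π 1 := by
  obtain ⟨a₀, -⟩ := (π s).support_nonempty
  have key : ∀ s' ∈ M.terminal, M.chain π s' = M.transition s a₀ := by
    intro s' hs'
    obtain ⟨s₀, h₀⟩ := M.init.support_nonempty
    have h₀' : 0 < M.init s₀ := pos_iff_ne_zero.mpr h₀
    have : M.transition s' = fun _ => M.transition s a₀ :=
      funext fun a => (hs' s₀ h₀' a a).trans (hs s₀ h₀' a₀ a).symm
    rw [chain, this, PMF.bind_const]
  ext x
  rw [key s hs, ← push_marginal, push]
  have : ∀ s', M.marginal π 0 s' * M.chain π s' x = M.init s' * M.transition s a₀ x := by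
    intro s'
    by_cases h0 : M.init s' = 0
    · simp [marginal, h0]
    · rw [key s' (h.mem_terminal h0)]; rfl
  simp only [this, ENNReal.tsum_mul_right, PMF.tsum_coe, one_mul]

theorem Homogeneous.push_eq (h : M.Homogeneous) (a : S → ℝ≥0∞) (x : S) :
    M.push π a x = M.terminalMass a * M.marginal π 1 x + M.killedPush π a x := by
  conv_lhs => rw [← M.indicator_terminal_add_compl a, push_add]
  simp only [Pi.add_apply, killedPush]
  congr 1
  rw [push, terminalMass, ← ENNReal.tsum_mul_right]
  refine tsum_congr fun s => ?_
  by_cases hs : s ∈ M.terminal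
  · rw [h.chain_eq_marginal_one π hs]
  · simp [hs]

theorem Homogeneous.terminalMass_init (h : M.Homogeneous) : M.terminalMass M.init = 1 := by
  rw [← M.init.tsum_coe, terminalMass]
  refine tsum_congr fun s => ?_
  by_cases h0 : M.init s = 0
  · by_cases hs : s ∈ M.terminal <;> simp [hs, h0]
  · simp [h.mem_terminal h0]

theorem terminalMass_le_tsum (a : S → ℝ≥0∞) : M.terminalMass a ≤ ∑' s, a s :=
  ENNReal.tsum_le_tsum fun s => Set.indicator_le_self _ _ s

theorem terminalMass_marginal_le_one (t : ℕ) : M.terminalMass (M.marginal π t) ≤ 1 :=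
  (terminalMass_le_tsum _).trans_eq (M.marginal π t).tsum_coe

theorem terminalMass_marginal_ne_top (t : ℕ) : M.terminalMass (M.marginal π t) ≠ ⊤ :=
  ne_top_of_le_ne_top ENNReal.one_ne_top (terminalMass_marginal_le_one π t)

theorem abs_toReal_terminalMass_marginal_le (t : ℕ) :
    |(M.terminalMass (M.marginal π t)).toReal| ≤ 1 := by
  rw [abs_of_nonneg ENNReal.toReal_nonneg]
  exact ENNReal.toReal_mono ENNReal.one_ne_top (terminalMass_marginal_le_one π t)

theorem terminalMass_sum {ι : Type*} (F : Finset ι) (c : ι → ℝ≥0∞) (a : ι → S → ℝ≥0∞) :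
    M.terminalMass (fun s => ∑ i ∈ F, c i * a i s) = ∑ i ∈ F, c i * M.terminalMass (a i) := by
  simp only [terminalMass, ← ENNReal.tsum_mul_left]
  rw [← Summable.tsum_finsetSum fun _ _ => ENNReal.summable]
  refine tsum_congr fun s => ?_
  by_cases hs : s ∈ M.terminal <;> simp [hs]

theorem killedPush_add (a b : S → ℝ≥0∞) :
    M.killedPush π (a + b) = M.killedPush π a + M.killedPush π b := by
  rw [killedPush, Set.indicator_add', push_add]
  rfl

theorem killedPush_sum {ι : Type*} (F : Finset ι) (c : ι → ℝ≥0∞) (a : ι → S → ℝ≥0∞) (x : S) :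
    M.killedPush π (fun s => ∑ i ∈ F, c i * a i s) x = ∑ i ∈ F, c i * M.killedPush π (a i) x := by
  simp only [killedPush, push, ← ENNReal.tsum_mul_left]
  rw [← Summable.tsum_finsetSum fun _ _ => ENNReal.summable]
  refine tsum_congr fun s => ?_
  by_cases hs : s ∈ M.terminal <;> simp [hs, Finset.sum_mul, mul_assoc]

/-- Decomposition of the marginal distributions at the last visit to a terminal state, which takes
place at time `t - k`. -/
theorem Homogeneous.marginal_succ_eq_sum (h : M.Homogeneous) (t : ℕ) (x : S) :
    M.marginal π (t + 1) x = ∑ k ∈ Finset.range (t + 1),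
      M.terminalMass (M.marginal π (t - k)) * M.excursion π k x := by
  induction t generalizing x with
  | zero => simp [marginal, h.terminalMass_init, excursion_zero]
  | succ t ih =>
    rw [← push_marginal, h.push_eq π, Finset.sum_range_succ', add_comm]
    congr 1
    have : (M.marginal π (t + 1) : S → ℝ≥0∞) = fun s => ∑ k ∈ Finset.range (t + 1),
      M.terminalMass (M.marginal π (t - k)) * M.excursion π k s := funext ih
    rw [this, killedPush_sum]
    simp [excursion_succ]

/-- The renewal equation for the probabilities of being in a terminal state. -/
theorem Homogeneous.terminalMass_marginal_succ (h : M.Homogeneous) (t : ℕ) :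
    M.terminalMass (M.marginal π (t + 1)) = ∑ k ∈ Finset.range (t + 1),
      M.terminalMass (M.marginal π (t - k)) * M.terminalMass (M.excursion π k) := by
  rw [← terminalMass_sum]
  exact congrArg _ (funext (h.marginal_succ_eq_sum π t))

theorem Homogeneous.sum_terminalMass_mul_tsum_excursion (h : M.Homogeneous) (t : ℕ) :
    ∑ k ∈ Finset.range (t + 1),
      M.terminalMass (M.marginal π (t - k)) * ∑' s, M.excursion π k s = 1 := by
  rw [← (M.marginal π (t + 1)).tsum_coe, tsum_congr (h.marginal_succ_eq_sum π t),
    Summable.tsum_finsetSum fun _ _ => ENNReal.summable]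
  simp [ENNReal.tsum_mul_left]

/-! ### Path sums and the law of the episode length -/

open Classical in
/-- The probability of the path `x` if all its interior states are non-terminal, and zero
otherwise. -/
noncomputable def pathWeight (M : MDP S A) (π : Policy S A) {n : ℕ} (x : Fin (n + 2) → S) : ℝ≥0∞ :=
  M.init (x 0) * (∏ i : Fin n, if x i.succ.castSucc ∈ M.terminal then 0 else 1) *
    ∏ i : Fin (n + 1), M.chain π (x i.castSucc) (x i.succ)

theorem pathWeight_snoc_snoc {n : ℕ} (y : Fin (n + 1) → S) (s' s : S) :
    M.pathWeight π (Fin.snoc (Fin.snoc y s' : Fin (n + 2) → S) s : Fin (n + 3) → S) =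
      M.terminalᶜ.indicator (fun s' => M.pathWeight π (Fin.snoc y s' : Fin (n + 2) → S)) s' *
        M.chain π s' s := by
  classical
  have h0 : ∀ (m : ℕ) (z : Fin (m + 1) → S) (b : S), (Fin.snoc z b : Fin (m + 2) → S) 0 = z 0 :=
    fun m z b => by rw [← Fin.castSucc_zero, Fin.snoc_castSucc (α := fun _ => S)]
  rw [pathWeight, Fin.prod_univ_castSucc, Fin.prod_univ_castSucc (n := n + 1)]
  simp only [h0, Fin.snoc_castSucc (α := fun _ => S), Fin.succ_last, Fin.snoc_last,
    Fin.succ_castSucc]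
  by_cases hs : s' ∈ M.terminal
  · simp [hs]
  · simp only [hs, if_false, mul_one, Set.mem_compl_iff, not_false_eq_true,
      Set.indicator_of_mem, pathWeight, h0, Fin.snoc_castSucc (α := fun _ => S), mul_assoc]

/-- Summing the weights of the paths with a prescribed last state gives the excursion law. -/
theorem tsum_pathWeight_snoc (n : ℕ) (s : S) :
    ∑' y : Fin (n + 1) → S, M.pathWeight π (Fin.snoc y s : Fin (n + 2) → S) =
      M.excursion π n s := by
  induction n generalizing s with
  | zero =>
    rw [excursion_zero, ← push_marginal, push, ← (Equiv.funUnique (Fin 1) S).symm.tsum_eq]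
    refine tsum_congr fun y => ?_
    simp [pathWeight, marginal, Fin.snoc]
  | succ n ih =>
    rw [excursion_succ, killedPush, push, ← (Fin.snocEquiv fun _ : Fin (n + 2) => S).tsum_eq,
      ENNReal.tsum_prod']
    refine tsum_congr fun s' => ?_
    change ∑' y : Fin (n + 1) → S,
      M.pathWeight π (Fin.snoc (Fin.snoc y s' : Fin (n + 2) → S) s : Fin (n + 3) → S) = _
    simp only [pathWeight_snoc_snoc, ENNReal.tsum_mul_right]
    by_cases hs : s' ∈ M.terminal
    · simp [hs]
    · simp [hs, ih]

/-- Segments as pairs of a length and a tuple of states. -/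
def segmentEquiv : (Σ n, Fin (n + 1) → S) ≃ Segment S where
  toFun p := ⟨p.1, p.2⟩
  invFun ξ := ⟨ξ.len, ξ.state⟩

theorem Homogeneous.indicator_admissible (h : M.Homogeneous) {n : ℕ} (x : Fin (n + 2) → S) :
    (M.admissible π).indicator (M.segProb π) ⟨n + 1, x⟩ =
      M.terminal.indicator (fun _ => M.pathWeight π x) (x (Fin.last _)) := by
  classical
  by_cases hx : M.IsEpisode ⟨n + 1, x⟩
  · have h1 : (M.admissible π).indicator (M.segProb π) ⟨n + 1, x⟩ = M.segProb π ⟨n + 1, x⟩ := by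
      rw [Set.indicator_apply_eq_self]
      intro hn
      by_contra h0
      exact hn ⟨hx, pos_iff_ne_zero.2 h0⟩
    obtain ⟨-, -, hlast, hint⟩ := hx
    rw [h1, Set.indicator_of_mem hlast, pathWeight, Finset.prod_eq_one, mul_one, segProb]
    intro i _
    refine if_neg (hint _ ?_ ?_)
    · simp [Fin.ext_iff]
    · simp [Fin.ext_iff]; omega
  · rw [Set.indicator_of_notMem fun hx' => hx hx'.1, eq_comm, Set.indicator_apply_eq_zero]
    intro hlast
    by_contra h0
    refine hx ⟨by simp, h.mem_terminal fun h' => h0 (by simp [pathWeight, h']), hlast, ?_⟩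
    intro i hi0 hil hit
    apply h0
    obtain ⟨j, rfl⟩ := Fin.exists_castSucc_eq.2 hil
    obtain ⟨k, rfl⟩ := Fin.exists_succ_eq.2 (fun hj : j = 0 => hi0 (by simp [hj]))
    rw [pathWeight, Finset.prod_eq_zero
      (f := fun i : Fin n => if x i.succ.castSucc ∈ M.terminal then 0 else 1)
      (Finset.mem_univ k) (if_pos hit), mul_zero, zero_mul]

/-- A sum over the admissible episodes that depends on their length only: an episode of length
`k + 1` occurs with the probability that `excursion k` sits in a terminal state. -/
theorem Homogeneous.tsum_admissible (h : M.Homogeneous) (φ : ℕ → ℝ≥0∞) :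
    ∑' ξ : M.admissible π, M.segProb π ξ * φ (ξ : Segment S).len =
      ∑' k, M.terminalMass (M.excursion π k) * φ (k + 1) := by
  have hlevel : ∀ k, ∑' x : Fin (k + 2) → S,
      (M.admissible π).indicator (M.segProb π) ⟨k + 1, x⟩ =
        M.terminalMass (M.excursion π k) := by
    intro k
    rw [terminalMass, ← (Fin.snocEquiv fun _ : Fin (k + 2) => S).tsum_eq, ENNReal.tsum_prod']
    refine tsum_congr fun s => ?_
    change ∑' y : Fin (k + 1) → S, (M.admissible π).indicator (M.segProb π)
      ⟨k + 1, (Fin.snoc y s : Fin (k + 2) → S)⟩ = _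
    rw [tsum_congr fun y => h.indicator_admissible π _]
    simp only [Fin.snoc_last]
    by_cases hs : s ∈ M.terminal
    · simp [hs, tsum_pathWeight_snoc]
    · simp [hs]
  rw [tsum_subtype (M.admissible π) fun ξ => M.segProb π ξ * φ ξ.len,
    ← segmentEquiv.tsum_eq, ENNReal.tsum_sigma', tsum_eq_zero_add' ENNReal.summable]
  have hzero : ∀ x : Fin 1 → S, (⟨0, x⟩ : Segment S) ∉ M.admissible π := fun x hx =>
    absurd hx.1.1 (by simp)
  simp only [segmentEquiv, Equiv.coe_fn_mk, Set.indicator_of_notMem (hzero _), tsum_zero, zero_add,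
    Set.indicator_mul_left, ← hlevel, ENNReal.tsum_mul_right]

theorem Homogeneous.terminalMass_excursion_pos (h : M.Homogeneous) {ξ : Segment S}
    (hξ : ξ ∈ M.admissible π) : ∃ k, ξ.len = k + 1 ∧ 0 < M.terminalMass (M.excursion π k) := by
  obtain ⟨k, hk⟩ : ∃ k, ξ.len = k + 1 := ⟨ξ.len - 1, by have := hξ.1.1; omega⟩
  refine ⟨k, hk, pos_iff_ne_zero.2 fun h0 => ?_⟩
  have h1 := h.tsum_admissible π (Pi.single (k + 1) 1)
  have h2 : ∀ j, M.terminalMass (M.excursion π j) *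
      (Pi.single (k + 1) 1 : ℕ → ℝ≥0∞) (j + 1) = 0 := by
    intro j
    by_cases hj : j = k
    · simp [hj, h0]
    · simp [hj]
  simp only [h2, tsum_zero, ENNReal.tsum_eq_zero] at h1
  have := h1 ⟨ξ, hξ⟩
  simp [hk, hξ.2.ne'] at this

theorem IsEpisodic.tsum_terminalMass (hM : M.IsEpisodic) :
    ∑' k, M.terminalMass (M.excursion π k) = 1 := by
  have := hM.homogeneous.tsum_admissible π fun _ => 1
  simpa [hM.sum_prob π] using this.symm

theorem sum_terminalMass_add_tsum_excursion (n : ℕ) :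
    ∑ k ∈ Finset.range n, M.terminalMass (M.excursion π k) + ∑' s, M.excursion π n s = 1 := by
  induction n with
  | zero => simp [excursion_zero, PMF.tsum_coe]
  | succ n ih =>
    rw [Finset.sum_range_succ, excursion_succ, add_assoc, terminalMass_add_tsum_killedPush, ih]

/-- As episodes are almost surely finite, the total mass of `excursion n` is the probability that
an episode has length at least `n + 1`. -/
theorem IsEpisodic.tsum_excursion_eq_tail (hM : M.IsEpisodic) (n : ℕ) :
    ∑' s, M.excursion π n s = ∑' k, M.terminalMass (M.excursion π (k + n)) := by
  have h1 := M.sum_terminalMass_add_tsum_excursion π n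
  rw [← hM.tsum_terminalMass π, ← ENNReal.summable.sum_add_tsum_nat_add' (k := n)] at h1
  refine (ENNReal.add_right_inj ?_).1 h1
  refine ne_top_of_le_ne_top ENNReal.one_ne_top ?_
  rw [← hM.tsum_terminalMass π]
  exact ENNReal.sum_le_tsum _

/-! ### The stationary distribution -/

/-- The mean episode length, written as the sum of its tail probabilities. -/
noncomputable def meanLength (M : MDP S A) (π : Policy S A) : ℝ≥0∞ :=
  ∑' k, ∑' s, M.excursion π k s

theorem IsEpisodic.meanLength_ne_top (hM : M.IsEpisodic) : M.meanLength π ≠ ⊤ := by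
  have h1 := hM.sum_length π
  rw [hM.homogeneous.tsum_admissible π fun n => (n : ℝ≥0∞)] at h1
  convert h1.ne
  simp only [meanLength, hM.tsum_excursion_eq_tail]
  -- Tonelli for the double sum over `n ≤ j`, in which the term with index `j` occurs `j + 1` times
  calc ∑' n, ∑' k, M.terminalMass (M.excursion π (k + n))
      = ∑' n, ∑' j, if n ≤ j then M.terminalMass (M.excursion π j) else 0 := by
        refine tsum_congr fun n => ?_
        conv_rhs => rw [← ENNReal.summable.sum_add_tsum_nat_add' (k := n)]
        rw [Finset.sum_eq_zero fun j hj => if_neg (by simpa using hj), zero_add]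
        simp
    _ = ∑' j, ∑' n, if n ≤ j then M.terminalMass (M.excursion π j) else 0 := ENNReal.tsum_comm
    _ = _ := by
        refine tsum_congr fun j => ?_
        rw [tsum_eq_sum (s := Finset.range (j + 1)) fun n hn => if_neg (by simpa using hn),
          Finset.sum_congr rfl fun n hn => if_pos (by simpa [Nat.lt_succ_iff] using hn)]
        simp [mul_comm]

theorem meanLength_ne_zero : M.meanLength π ≠ 0 := by
  intro h
  have := ENNReal.tsum_eq_zero.1 h 0
  simp [excursion_zero, PMF.tsum_coe] at this

/-- The expected number of visits to `s` during an episode, not counting its initial state. -/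
noncomputable def occupation (M : MDP S A) (π : Policy S A) (s : S) : ℝ≥0∞ :=
  ∑' k, M.excursion π k s

theorem tsum_occupation : ∑' s, M.occupation π s = M.meanLength π := ENNReal.tsum_comm

theorem IsEpisodic.push_occupation (hM : M.IsEpisodic) :
    M.push π (M.occupation π) = M.occupation π := by
  have h0 : M.occupation π = fun s => ∑' k, M.excursion π k s := rfl
  rw [h0, push_tsum]
  funext s
  simp only [hM.homogeneous.push_eq, ← excursion_succ]
  rw [ENNReal.tsum_add, ENNReal.tsum_mul_right, hM.tsum_terminalMass, one_mul, ← excursion_zero]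
  exact (tsum_eq_zero_add' (f := fun k => M.excursion π k s) ENNReal.summable).symm

theorem killedPush_le_push (a : S → ℝ≥0∞) (s : S) : M.killedPush π a s ≤ M.push π a s :=
  ENNReal.tsum_le_tsum fun s => by gcongr; exact Set.indicator_le_self _ _ s

theorem push_mono {a b : S → ℝ≥0∞} (hab : a ≤ b) : M.push π a ≤ M.push π b := fun s =>
  ENNReal.tsum_le_tsum fun s' => by gcongr; exact hab s'

theorem excursion_le_marginal (k : ℕ) : M.excursion π k ≤ M.marginal π (k + 1) := by
  induction k with
  | zero => exact le_rfl
  | succ k ih =>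
    rw [excursion_succ, ← push_marginal]
    exact le_trans (killedPush_le_push π _) (push_mono π ih)

theorem occupation_eq_zero {s : S} (hs : s ∉ M.reachable π) : M.occupation π s = 0 := by
  refine ENNReal.tsum_eq_zero.2 fun k => ?_
  by_contra h0
  exact hs ⟨k + 1, by simp, (pos_iff_ne_zero.2 h0).trans_le (excursion_le_marginal π k s)⟩

theorem Homogeneous.exists_excursion_ne_zero (h : M.Homogeneous) {s : S}
    (hs : s ∈ M.reachable π) : ∃ k, M.excursion π k s ≠ 0 := by
  obtain ⟨t, ht, hpos⟩ := hs
  obtain ⟨t, rfl⟩ := Nat.exists_eq_add_of_le' ht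
  by_contra! hk
  simp [h.marginal_succ_eq_sum, hk] at hpos

/-- The normalized occupation measure of an episode. -/
noncomputable def stationary (hM : M.IsEpisodic) : PMF S :=
  ⟨fun s => (M.meanLength π)⁻¹ * M.occupation π s, by
    rw [ENNReal.summable.hasSum_iff, ENNReal.tsum_mul_left, tsum_occupation]
    exact ENNReal.inv_mul_cancel (meanLength_ne_zero π) (hM.meanLength_ne_top π)⟩

theorem stationary_apply (hM : M.IsEpisodic) (s : S) :
    stationary π hM s = (M.meanLength π)⁻¹ * M.occupation π s := rfl

theorem isStationary_stationary (hM : M.IsEpisodic) : M.IsStationary π (stationary π hM) := by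
  constructor
  · ext s
    rw [PMF.bind_apply]
    change M.push π (fun s => (M.meanLength π)⁻¹ * M.occupation π s) s = _
    rw [push_const_mul, hM.push_occupation]
    rfl
  · intro s hs
    rw [stationary_apply, occupation_eq_zero π hs, mul_zero]

/-! ### Uniqueness -/

/-- The probability that the chain started in `s` visits no terminal state at the times
`0, …, n - 1`. -/
noncomputable def survival (M : MDP S A) (π : Policy S A) : ℕ → S → ℝ≥0∞
  | 0 => 1
  | n + 1 => M.terminalᶜ.indicator fun s => ∑' s', M.chain π s s' * M.survival π n s'

theorem survival_le_one (n : ℕ) (s : S) : M.survival π n s ≤ 1 := by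
  induction n generalizing s with
  | zero => exact le_rfl
  | succ n ih =>
    refine (Set.indicator_le_self _ _ s).trans ?_
    calc ∑' s', M.chain π s s' * M.survival π n s' ≤ ∑' s', M.chain π s s' * 1 :=
          ENNReal.tsum_le_tsum fun s' => by gcongr; exact ih s'
      _ = 1 := by simp [PMF.tsum_coe]

/-- Duality between the killed chain acting on masses and on survival probabilities. -/
theorem tsum_iterate_killedPush (n : ℕ) (a : S → ℝ≥0∞) :
    ∑' s, (M.killedPush π)^[n] a s = ∑' s, a s * M.survival π n s := by
  induction n generalizing a with
  | zero => simp [survival]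
  | succ n ih =>
    rw [Function.iterate_succ_apply, ih]
    simp only [killedPush, push, ← ENNReal.tsum_mul_right]
    rw [ENNReal.tsum_comm]
    refine tsum_congr fun s => ?_
    by_cases hs : s ∈ M.terminal
    · simp [hs, survival]
    · simp [hs, survival, mul_assoc, ENNReal.tsum_mul_left]

theorem IsEpisodic.tendsto_tsum_excursion (hM : M.IsEpisodic) :
    Tendsto (fun n => ∑' s, M.excursion π n s) atTop (𝓝 0) :=
  ENNReal.tendsto_atTop_zero_of_tsum_ne_top (hM.meanLength_ne_top π)

/-- If `excursion k` charges `s`, then surviving `n` steps from `s` contributes to the mass of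
`excursion (n + k)`, which tends to zero. -/
theorem IsEpisodic.tendsto_survival (hM : M.IsEpisodic) {s : S} (hs : s ∈ M.reachable π) :
    Tendsto (fun n => M.survival π n s) atTop (𝓝 0) := by
  obtain ⟨k, hk⟩ := hM.homogeneous.exists_excursion_ne_zero π hs
  have hle : ∀ n, M.survival π n s ≤ (M.excursion π k s)⁻¹ * ∑' x, M.excursion π (n + k) x := by
    intro n
    have htop : M.excursion π k s ≠ ⊤ :=
      ne_top_of_le_ne_top ((M.marginal π (k + 1)).apply_ne_top s) (excursion_le_marginal π k s)
    rw [← ENNReal.div_eq_inv_mul, ENNReal.le_div_iff_mul_le (.inl hk) (.inl htop), mul_comm]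
    have hadd : M.excursion π (n + k) = (M.killedPush π)^[n] (M.excursion π k) :=
      Function.iterate_add_apply _ _ _ _
    rw [hadd, tsum_iterate_killedPush]
    exact ENNReal.le_tsum (f := fun x => M.excursion π k x * M.survival π n x) s
  refine tendsto_of_tendsto_of_tendsto_of_le_of_le tendsto_const_nhds ?_ (fun _ => zero_le) hle
  have := ENNReal.Tendsto.const_mul (a := (M.excursion π k s)⁻¹)
    ((tendsto_add_atTop_iff_nat k).2 (hM.tendsto_tsum_excursion π)) (.inr (ENNReal.inv_ne_top.2 hk))
  simpa using this

theorem IsEpisodic.tendsto_tsum_mul_survival (hM : M.IsEpisodic) (ρ : PMF S)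
    (hρ : ∀ s, s ∉ M.reachable π → ρ s = 0) :
    Tendsto (fun n => ∑' s, ρ s * M.survival π n s) atTop (𝓝 0) := by
  let _ : MeasurableSpace S := ⊤
  have := MeasureTheory.tendsto_lintegral_of_dominated_convergence
    (μ := MeasureTheory.Measure.count) (F := fun n s => ρ s * M.survival π n s)
    (f := fun _ => 0) (bound := ρ) (fun _ => measurable_from_top)
    (fun n => .of_forall fun s => mul_le_of_le_one_right' (survival_le_one π n s))
    (by rw [MeasureTheory.lintegral_count, ρ.tsum_coe]; exact ENNReal.one_ne_top)
    (.of_forall fun s => by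
      by_cases hs : s ∈ M.reachable π
      · simpa using ENNReal.Tendsto.const_mul (a := ρ s) (hM.tendsto_survival π hs)
          (.inr (ρ.apply_ne_top s))
      · simp [hρ s hs])
  simpa [MeasureTheory.lintegral_count] using this

/-- An invariant mass function splits according to the last visit to a terminal state within the
preceding `n` steps; the remainder is the mass without such a visit. -/
theorem Homogeneous.eq_sum_add_iterate (h : M.Homogeneous) {a : S → ℝ≥0∞}
    (ha : M.push π a = a) (n : ℕ) (s : S) :
    a s = ∑ k ∈ Finset.range n, M.terminalMass a * M.excursion π k s +
      (M.killedPush π)^[n] a s := by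
  induction n generalizing s with
  | zero => simp
  | succ n ih =>
    conv_lhs => rw [← ha, h.push_eq]
    rw [Finset.sum_range_succ', add_comm (∑ k ∈ _, _), add_assoc, ← excursion_zero]
    congr 1
    have h2 : M.killedPush π a s = M.killedPush π (fun s => ∑ k ∈ Finset.range n,
        M.terminalMass a * M.excursion π k s + (M.killedPush π)^[n] a s) s :=
      congrArg (fun b => M.killedPush π b s) (funext ih)
    rw [h2, Function.iterate_succ_apply']
    simp only [excursion_succ]
    rw [← killedPush_sum, ← Pi.add_apply, ← killedPush_add]
    rfl

theorem IsEpisodic.eq_stationary (hM : M.IsEpisodic) {ρ : PMF S} (hρ : M.IsStationary π ρ) :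
    ρ = stationary π hM := by
  have hpush : M.push π ρ = ρ := by
    conv_rhs => rw [← hρ.1]
    exact funext fun s => (PMF.bind_apply _ _ _).symm
  have hrem := hM.tendsto_tsum_mul_survival π ρ hρ.2
  simp only [← tsum_iterate_killedPush] at hrem
  have hocc : ∀ s, ρ s = M.terminalMass ρ * M.occupation π s := by
    intro s
    have h1 : Tendsto (fun n => (M.killedPush π)^[n] ρ s) atTop (𝓝 0) :=
      tendsto_of_tendsto_of_tendsto_of_le_of_le tendsto_const_nhds hrem (fun _ => zero_le)
        (fun n => ENNReal.le_tsum s)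
    have h2 := (ENNReal.tendsto_nat_tsum fun k => M.terminalMass ρ * M.excursion π k s).add h1
    simp only [← hM.homogeneous.eq_sum_add_iterate π hpush, add_zero, ENNReal.tsum_mul_left] at h2
    exact tendsto_nhds_unique tendsto_const_nhds h2
  have hmass : M.terminalMass ρ * M.meanLength π = 1 := by
    rw [← tsum_occupation, ← ENNReal.tsum_mul_left, ← ρ.tsum_coe]
    exact tsum_congr fun s => (hocc s).symm
  ext s
  rw [stationary_apply, hocc s, ENNReal.eq_inv_of_mul_eq_one_left hmass]

/-! ### Convergence -/

theorem IsEpisodic.tendsto_terminalMass (hM : M.IsEpisodic)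
    (h : ∃ ξ ∈ M.admissible π, ∃ ξ' ∈ M.admissible π, Nat.gcd ξ.len ξ'.len = 1) :
    Tendsto (fun t => (M.terminalMass (M.marginal π t)).toReal) atTop
      (𝓝 (M.meanLength π).toReal⁻¹) := by
  obtain ⟨ξ, hξ, ξ', hξ', hgcd⟩ := h
  obtain ⟨a, ha, ha'⟩ := hM.homogeneous.terminalMass_excursion_pos π hξ
  obtain ⟨b, hb, hb'⟩ := hM.homogeneous.terminalMass_excursion_pos π hξ'
  have hG : ∀ k, ∑' s, M.excursion π k s ≠ ⊤ := ENNReal.ne_top_of_tsum_ne_top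
    (hM.meanLength_ne_top π)
  have hf : ∀ k, M.terminalMass (M.excursion π k) ≠ ⊤ := fun k =>
    ne_top_of_le_ne_top (hG k) (terminalMass_le_tsum _)
  rw [meanLength, ENNReal.tsum_toReal_eq hG]
  refine tendsto_inv_tsum_of_renewal (f := fun k => (M.terminalMass (M.excursion π k)).toReal)
    (abs_toReal_terminalMass_marginal_le π) (fun k => ENNReal.toReal_nonneg)
    ?_ ?_ (fun t => ?_) (fun t => ?_)
    (ENNReal.toReal_pos ha'.ne' (hf a)) (ENNReal.toReal_pos hb'.ne' (hf b)) (by rwa [← ha, ← hb])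
  · have := ENNReal.hasSum_toReal (f := fun k => M.terminalMass (M.excursion π k))
      (by rw [hM.tsum_terminalMass]; exact ENNReal.one_ne_top)
    rwa [← ENNReal.tsum_toReal_eq hf, hM.tsum_terminalMass, ENNReal.toReal_one] at this
  · simpa using ENNReal.summable_toReal (hM.meanLength_ne_top π)
  · rw [hM.homogeneous.terminalMass_marginal_succ,
      ENNReal.toReal_sum fun k _ => ENNReal.mul_ne_top (terminalMass_marginal_ne_top π _) (hf k)]
    simp only [ENNReal.toReal_mul]
  · have := congrArg ENNReal.toReal (hM.homogeneous.sum_terminalMass_mul_tsum_excursion π t)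
    rw [ENNReal.toReal_sum fun k _ =>
      ENNReal.mul_ne_top (terminalMass_marginal_ne_top π _) (hG k)] at this
    simpa only [ENNReal.toReal_mul, ENNReal.toReal_one] using this

theorem IsEpisodic.tendsto_marginal (hM : M.IsEpisodic)
    (h : ∃ ξ ∈ M.admissible π, ∃ ξ' ∈ M.admissible π, Nat.gcd ξ.len ξ'.len = 1) (s : S) :
    Tendsto (fun t => M.marginal π t s) atTop (𝓝 (stationary π hM s)) := by
  have hocc : M.occupation π s ≠ ⊤ := ne_top_of_le_ne_top (hM.meanLength_ne_top π)
    ((ENNReal.le_tsum s).trans_eq (tsum_occupation π))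
  have hexc : ∀ k, M.excursion π k s ≠ ⊤ := ENNReal.ne_top_of_tsum_ne_top hocc
  rw [← tendsto_add_atTop_iff_nat 1, ← ENNReal.tendsto_toReal_iff
    (fun t => (M.marginal π (t + 1)).apply_ne_top s) ((stationary π hM).apply_ne_top s)]
  have := tendsto_convolution (l := atTop) (w := fun k => (M.excursion π k s).toReal) le_rfl
    (abs_toReal_terminalMass_marginal_le π)
    (by simpa using ENNReal.summable_toReal hocc)
    (fun k => (hM.tendsto_terminalMass π h).comp (tendsto_sub_atTop_nat k))
  rw [tsum_mul_left, ← ENNReal.tsum_toReal_eq hexc] at this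
  rw [stationary_apply, ENNReal.toReal_mul, ENNReal.toReal_inv]
  refine this.congr fun t => ?_
  rw [hM.homogeneous.marginal_succ_eq_sum,
    ENNReal.toReal_sum fun k _ => ENNReal.mul_ne_top (terminalMass_marginal_ne_top π _) (hexc k)]
  simp only [ENNReal.toReal_mul]

end MDP

theorem mainTheorem2 {S A : Type*} [Countable S] [Countable A] (M : MDP S A)
    (hM : M.IsEpisodic) (π : MDP.Policy S A)
    (h : ∃ ξ ∈ M.admissible π, ∃ ξ' ∈ M.admissible π, ξ ≠ ξ' ∧ Nat.gcd ξ.len ξ'.len = 1) :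
    ∃ ρ : PMF S, M.IsStationary π ρ ∧ (∀ ρ' : PMF S, M.IsStationary π ρ' → ρ' = ρ) ∧
      ∀ s, Tendsto (fun t => M.marginal π t s) atTop (𝓝 (ρ s)) := by
  obtain ⟨ξ, hξ, ξ', hξ', -, hgcd⟩ := h
  exact ⟨MDP.stationary π hM, MDP.isStationary_stationary π hM, fun _ h => hM.eq_stationary π h,
    hM.tendsto_marginal π ⟨ξ, hξ, ξ', hξ', hgcd⟩⟩
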